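/- \textbf{Definitions.} All logarithms are natural. A \emph{balanced bichromatic point set of size $2n$} is a set $S=R\cup B$ of points of the Euclidean plane, where $R$ (the red points) and $B$ (the blue points) are disjoint sets with $|R|=|B|=n$; $S$ is in \emph{general position} if no three distinct points of $S$ are collinear. A \emph{configuration} of length $2n$ is a circular sequence (a word up to cyclic rotation) consisting of $n$ letters $r$ and $n$ letters $b$; let $\Gamma(n)$ be the number of configurations of length $2n$. A \emph{set of rays from $S$} is a set $H$ of closed rays, exactly one with apex $p$ for each $p\in S$, each ray inheriting the colour of its apex. If the rays of $H$ are pairwise disjoint, they induce a circular sequence of colours $C(S,H)$ at infinity: the colours, in clockwise order, of the points in which the rays meet any sufficiently large circle enclosing $S$. A configuration $C$ is \emph{feasible} from $S$ if $C=C(S,H)$ for some set $H$ of pairwise-disjoint rays from $S$. Let $\gamma(S)$ be the number of different configurations that are feasible from $S$, and let $\gamma^{\min}_{\rm gp}(n)$ be the minimum of $\gamma(S)$ over all balanced bichromatic point sets $S$ of size $2n$ in general position. \textbf{Theorem.} There is a constant $d>0$ such that, as $n\to\infty$, \[ \gamma^{\min}_{\rm gp}(n)=O\bigl(2^{d\sqrt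 n\,\log n}\bigr). \] Moreover, there are point sets for which the number of feasible configurations is asymptotically smaller than $\Gamma(n)$: there is a family $(S_n)_{n\ge 0}$, where $S_n$ is a balanced bichromatic point set of size $2n$ in general position, such that $\gamma(S_n)=o(\Gamma(n))$ as $n\to\infty$. -/

import Mathlib

open Filter Asymptotics

/-- The Euclidean plane. -/
abbrev Plane := EuclideanSpace ℝ (Fin 2)

/-- A finite bichromatic point set `R ∪ B`: a finite set of red points and a finite set of blue
points, with no point in both. -/
structure BichromaticPointSet where
  red : Finset Plane
  blue : Finset Plane
  disj : Disjoint red blue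

namespace BichromaticPointSet

/-- The underlying set of points `S = R ∪ B`. -/
def points (S : BichromaticPointSet) : Set Plane :=
  {p | p ∈ S.red ∨ p ∈ S.blue}

/-- `S` is balanced of size `2n`: it has `n` red points and `n` blue points. -/
def IsBalanced (S : BichromaticPointSet) (n : ℕ) : Prop :=
  S.red.card = n ∧ S.blue.card = n

/-- General position: no three distinct points of `S` are collinear. -/
def GeneralPosition (S : BichromaticPointSet) : Prop :=
  ∀ p ∈ S.points, ∀ q ∈ S.points, ∀ r ∈ S.points,
    p ≠ q → q ≠ r → p ≠ r → ¬ Collinear ℝ ({p, q, r} : Set Plane)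

open Classical in
/-- The colour of a point of `S`: `true` is red, `false` is blue. -/
noncomputable def colour (S : BichromaticPointSet) (p : Plane) : Bool :=
  decide (p ∈ S.red)

end BichromaticPointSet

/-- The closed ray `h(p, v) = {p + t v | t ≥ 0}` with apex `p` and direction `v`. -/
def ray (p v : Plane) : Set Plane :=
  {q | ∃ t : ℝ, 0 ≤ t ∧ q = p + t • v}

/-- The point at angle `θ` (counterclockwise from the positive `x`-axis) on the circle of radius
`ρ` centred at the origin. -/
noncomputable def circlePoint (ρ θ : ℝ) : Plane :=
  !₂[ρ * Real.cos θ, ρ * Real.sin θ]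

namespace BichromaticPointSet

/-- The direction assignment `v` defines a set of pairwise-disjoint rays from `S`: every point `p`
of `S` is the apex of the ray `h(p, v p)`, with `v p ≠ 0`. -/
def DisjointRays (S : BichromaticPointSet) (v : Plane → Plane) : Prop :=
  (∀ p ∈ S.points, v p ≠ 0) ∧
    ∀ p ∈ S.points, ∀ q ∈ S.points, p ≠ q → Disjoint (ray p (v p)) (ray q (v q))

/-- `C` is the circular sequence `C(S, H)` of colours that the rays `H = {h(p, v p) | p ∈ S}`
induce at infinity, in clockwise order. That is, for every sufficiently large circle, the points of
`S` can be listed, each one once, as `p₁, …, pₘ` so that the ray of `pᵢ` meets the circle at angle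
`θ pᵢ`, where `θ p₁ > θ p₂ > … > θ pₘ > θ p₁ - 2π` (so that the list runs clockwise, once around
the circle), and `C` is the list of colours of `p₁, …, pₘ` up to rotation. -/
def InducesCircularSequence (S : BichromaticPointSet) (v : Plane → Plane) (C : Cycle Bool) : Prop :=
  ∀ᶠ ρ : ℝ in atTop, ∃ (l : List Plane) (θ : Plane → ℝ),
    l.Nodup ∧ (∀ p, p ∈ l ↔ p ∈ S.points) ∧
    (∀ p ∈ l, circlePoint ρ (θ p) ∈ ray p (v p)) ∧
    l.Pairwise (fun p q => θ q < θ p ∧ θ p < θ q + 2 * Real.pi) ∧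
    C = ((l.map S.colour : List Bool) : Cycle Bool)

/-- `C` is feasible from `S`: it is realized by some set of pairwise-disjoint rays from `S`. -/
def Feasible (S : BichromaticPointSet) (C : Cycle Bool) : Prop :=
  ∃ v : Plane → Plane, S.DisjointRays v ∧ S.InducesCircularSequence v C

end BichromaticPointSet

/-- The configurations of length `2n`: circular sequences (words up to rotation) with `n` red and
`n` blue elements. -/
def configurations (n : ℕ) : Set (Cycle Bool) :=
  {C | C.toMultiset.count true = n ∧ C.toMultiset.count false = n}

/-- `Γ(n)`, the number of configurations of length `2n`. -/
noncomputable def numConfigurations (n : ℕ) : ℕ :=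
  (configurations n).ncard

/-- `γ(S)`, the number of different configurations that are feasible from `S`. -/
noncomputable def numFeasible (S : BichromaticPointSet) : ℕ :=
  {C : Cycle Bool | S.Feasible C}.ncard

/-- `γ^min_gp(n)`, the minimum of `γ(S)` over all balanced bichromatic sets `S` of `2n` points of
the plane in general position. -/
noncomputable def gammaMinGP (n : ℕ) : ℕ :=
  sInf {m : ℕ | ∃ S : BichromaticPointSet, S.IsBalanced n ∧ S.GeneralPosition ∧ numFeasible S = m}

/-- There are finitely many configurations of each length. -/
theorem configurations_finite (n : ℕ) : (configurations n).Finite := by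
  refine ((List.finite_length_eq Bool (2 * n)).image (fun l : List Bool => (l : Cycle Bool))).subset
    fun C hC => ?_
  obtain ⟨l, rfl⟩ := Quotient.exists_rep C
  refine ⟨l, ?_, rfl⟩
  have h1 : ((l : Multiset Bool)).count true = n := hC.1
  have h2 : ((l : Multiset Bool)).count false = n := hC.2
  rw [Multiset.coe_count] at h1 h2
  have := List.count_true_add_count_false l
  change l.length = 2 * n
  omega

/-- Every circular sequence that is feasible from a balanced set of `2n` points is a
configuration of length `2n`. -/
theorem BichromaticPointSet.Feasible.mem_configurations {S : BichromaticPointSet} {n : ℕ}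
    (hS : S.IsBalanced n) {C : Cycle Bool} (hC : S.Feasible C) : C ∈ configurations n := by
  classical
  obtain ⟨v, -, h⟩ := hC
  obtain ⟨ρ, l, θ, hl, hmem, -, -, rfl⟩ := h.exists
  have hp : l.Perm (S.red.toList ++ S.blue.toList) := by
    refine (List.perm_ext_iff_of_nodup hl ?_).2 fun p => by simp [hmem, points]
    refine List.Nodup.append S.red.nodup_toList S.blue.nodup_toList ?_
    intro p h1 h2
    exact Finset.disjoint_left.1 S.disj (by simpa using h1) (by simpa using h2)
  have hr : S.red.toList.map S.colour = List.replicate n true := by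
    refine List.eq_replicate_iff.2 ⟨by simp [hS.1], fun b hb => ?_⟩
    obtain ⟨p, hp, rfl⟩ := List.mem_map.1 hb
    simpa [colour] using hp
  have hb : S.blue.toList.map S.colour = List.replicate n false := by
    refine List.eq_replicate_iff.2 ⟨by simp [hS.2], fun b hb => ?_⟩
    obtain ⟨p, hp, rfl⟩ := List.mem_map.1 hb
    simp only [colour, decide_eq_false_iff_not]
    exact fun h => Finset.disjoint_left.1 S.disj h (by simpa using hp)
  have hm := hp.map S.colour
  rw [List.map_append, hr, hb] at hm
  have h1 := hm.count_eq true
  have h2 := hm.count_eq false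
  simp [List.count_replicate] at h1 h2
  exact ⟨by simpa [Cycle.coe_toMultiset] using h1, by simpa [Cycle.coe_toMultiset] using h2⟩

/-! Circular words of length 2n with O(√n) runs number only exp(O(√n log n))
(`ncard_cycles_few_runs_le`), while Γ(n) is 4^n up to a polynomial factor. Both claims therefore
follow from one point set all of whose feasible words have O(√n) runs.

In `clusteredSet` the red points lie near x = -1 at unit vertical spacing. The blue points lie near
x = 1 in about √n clusters of about √n points, each cluster of height at most 1/4, and different
clusters farther apart than any two red points. Both arcs are almost vertical; their slight
curvature gives general position.

The geometric core is `RayBlock.gap_lt`. Among rays leaving through the right half of a large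
circle, let the rays of two left points lie, at infinity, between the rays of two right points.
Disjointness makes the left rays pass between the right points themselves and keeps them from
converging, so the left points are no farther apart than the right ones, up to an error below 1/2.
On the right half circle, two red points then never fit between two blue points of one cluster, so
the alternations are bounded by the number of clusters (`RayBlock.length_le_of_clusters_right`). On
the left half circle the roles are exchanged: blue points of different clusters never fit between
two red points, so the alternations are bounded by the size of one cluster
(`RayBlock.length_le_of_clusters_left`). A full turn meets at most three half-circle blocks, which
gives `exists_word_few_runs`. -/

/-! ### Counting circular words with few runs -/

/-- The word whose consecutive runs have lengths `cs`, with letters alternating from `a`. -/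
def wordOfRuns : Bool → List ℕ → List Bool
  | _, [] => []
  | a, c :: cs => List.replicate c a ++ wordOfRuns (!a) cs

theorem wordOfRuns_replicate_zero (K : ℕ) (a : Bool) :
    wordOfRuns a (List.replicate K 0) = [] := by
  induction K generalizing a with
  | zero => rfl
  | succ K ih => simp [List.replicate_succ, wordOfRuns, ih]

/-- Runs of length 0 are allowed on purpose: they pad the list to a prescribed length, and an empty
first run accommodates a word that does not begin with `a`. -/
theorem exists_wordOfRuns_eq (l : List Bool) (a : Bool) (K : ℕ)
    (h : (l.destutter' (· ≠ ·) a).length ≤ K + 1) :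
    ∃ cs : List ℕ, cs.length = K + 1 ∧ (∀ c ∈ cs, c ≤ l.length) ∧ wordOfRuns a cs = l := by
  induction l generalizing a K with
  | nil => exact ⟨List.replicate (K + 1) 0, by simp, by simp, wordOfRuns_replicate_zero _ _⟩
  | cons x l ih =>
    have incr : ∀ K, (l.destutter' (· ≠ ·) x).length ≤ K + 1 →
        ∃ c cs, cs.length = K ∧ c ≤ l.length + 1 ∧ (∀ c ∈ cs, c ≤ l.length + 1) ∧
          wordOfRuns x (c :: cs) = x :: l := by
      intro K hK
      obtain ⟨cs, h1, h2, h3⟩ := ih x K hK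
      obtain _ | ⟨c, cs⟩ := cs
      · simp at h1
      · refine ⟨c + 1, cs, by simpa using h1, ?_, fun d hd => ?_, ?_⟩
        · have := h2 c (by simp); omega
        · have := h2 d (by simp [hd]); omega
        · rw [← h3]; simp [wordOfRuns, List.replicate_succ]
    by_cases hx : a = x
    · subst hx
      rw [List.destutter'_cons_neg (h := by simp)] at h
      obtain ⟨c, cs, h1, h2, h3, h4⟩ := incr K h
      exact ⟨c :: cs, by simp [h1], by simpa using ⟨h2, h3⟩, h4⟩
    · rw [List.destutter'_cons_pos (h := hx)] at h
      obtain _ | K := K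
      · simp [List.destutter'_ne_nil] at h
      obtain ⟨c, cs, h1, h2, h3, h4⟩ := incr K (by simpa using h)
      refine ⟨0 :: c :: cs, by simp [h1], by simpa using ⟨h2, h3⟩, ?_⟩
      have : (!a) = x := by cases a <;> cases x <;> simp_all
      rw [wordOfRuns, this, h4]; simp

/-- There are at most `2 (N + 1) ^ (K + 1)` circular words of length `N` that can be cut into a
word with at most `K + 1` runs. -/
theorem ncard_cycles_few_runs_le (N K : ℕ) :
    {C : Cycle Bool | ∃ l : List Bool, C = l ∧ l.length = N ∧
      (l.destutter (· ≠ ·)).length ≤ K + 1}.Finite ∧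
    {C : Cycle Bool | ∃ l : List Bool, C = l ∧ l.length = N ∧
      (l.destutter (· ≠ ·)).length ≤ K + 1}.ncard ≤ 2 * (N + 1) ^ (K + 1) := by
  let g : Bool × (Fin (K + 1) → Fin (N + 1)) → Cycle Bool := fun x =>
    (wordOfRuns x.1 (List.ofFn fun i => ((x.2 i : Fin (N + 1)) : ℕ)) : List Bool)
  have hsub : {C : Cycle Bool | ∃ l : List Bool, C = l ∧ l.length = N ∧
      (l.destutter (· ≠ ·)).length ≤ K + 1} ⊆ Set.range g := by
    rintro C ⟨l, rfl, hN, hK⟩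
    obtain ⟨a, ha⟩ : ∃ a, (l.destutter' (· ≠ ·) a).length ≤ K + 1 := by
      obtain _ | ⟨x, l⟩ := l
      · exact ⟨true, by simp⟩
      · refine ⟨x, ?_⟩
        rw [List.destutter'_cons_neg (h := by simp)]
        rwa [List.destutter_cons'] at hK
    obtain ⟨cs, h1, h2, h3⟩ := exists_wordOfRuns_eq l a K ha
    refine ⟨(a, fun i => ⟨cs[i.1], ?_⟩), ?_⟩
    · have := h2 (cs[i.1]) (List.getElem_mem _)
      omega
    · have : (List.ofFn fun i : Fin (K + 1) => cs[i.1]) = cs := by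
        refine List.ext_getElem (by simp [h1]) fun i _ _ => ?_
        rw [List.getElem_ofFn]
      simp only [g]
      rw [this, h3]
  refine ⟨(Set.finite_range g).subset hsub, ?_⟩
  refine (Set.ncard_le_ncard hsub (Set.finite_range g)).trans ?_
  rw [← Set.image_univ]
  refine (Set.ncard_image_le Set.finite_univ).trans ?_
  simp [Set.ncard_univ]

/-! ### Lower bound for the number of configurations -/

theorem count_true_ofFn {N : ℕ} (s : Finset (Fin N)) :
    (List.ofFn fun i => decide (i ∈ s)).count true = s.card := by
  rw [List.ofFn_eq_map, List.count, List.countP_map, List.countP_eq_length_filter,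
    ← List.toFinset_card_of_nodup ((List.nodup_finRange N).filter _)]
  congr 1
  ext i
  simp

/-- There are at least `(2n choose n) / (2n + 1)` configurations of length `2n`. -/
theorem centralBinom_le_mul_numConfigurations (n : ℕ) :
    n.centralBinom ≤ (2 * n + 1) * numConfigurations n := by
  classical
  let w : Finset (Fin (2 * n)) → List Bool := fun s => List.ofFn fun i => decide (i ∈ s)
  have hw : Function.Injective w := fun s t h => by
    ext i
    have := congrFun (List.ofFn_injective h) i
    simpa using this
  let W := (Finset.univ.powersetCard n).image w
  have hW : W.card = n.centralBinom := by
    rw [Finset.card_image_of_injective _ hw, Finset.card_powersetCard]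
    simp [Nat.centralBinom]
  have hlen : ∀ l ∈ W, l.length = 2 * n := by
    intro l hl
    obtain ⟨s, -, rfl⟩ := Finset.mem_image.1 hl
    simp [w]
  rw [← hW]
  refine (Finset.card_le_mul_card_image (f := fun l : List Bool => (l : Cycle Bool)) W (2 * n + 1)
    ?_).trans ?_
  · intro C hC
    obtain ⟨l, hl, rfl⟩ := Finset.mem_image.1 hC
    -- The fibre over a circular word consists of the rotations of a single word, whence the factor
    -- `2 * n + 1`.
    refine (Finset.card_le_card (t := ((List.range (2 * n + 1)).map l.rotate).toFinset) ?_).trans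
      ((List.toFinset_card_le _).trans (by simp))
    intro l' hl'
    rw [Finset.mem_filter] at hl'
    have := List.isRotated_iff_mem_map_range.1 (Cycle.coe_eq_coe.1 hl'.2).symm
    rw [hlen l hl] at this
    simpa using this
  · gcongr
    rw [numConfigurations, ← Set.ncard_coe_finset]
    refine Set.ncard_le_ncard ?_ (configurations_finite n)
    intro C hC
    obtain ⟨l, hl, rfl⟩ := Finset.mem_image.1 (Finset.mem_coe.1 hC)
    have h2 := hlen l hl
    obtain ⟨s, hs, rfl⟩ := Finset.mem_image.1 hl
    have h1 : (w s).count true = n := by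
      rw [count_true_ofFn]; exact (Finset.mem_powersetCard.1 hs).2
    have := List.count_true_add_count_false (w s)
    have h3 : (w s).count false = n := by omega
    exact ⟨by simpa [Cycle.coe_toMultiset] using h1, by simpa [Cycle.coe_toMultiset] using h3⟩

/-! ### Plane geometry of two disjoint rays -/

/-- If `(x, y)` and `(x', y')` lie on the right half of a circle, `(x', y')` being lower, and the
line from the interior point `(px, py)` to `(x, y)` runs to the right, then the line is not below
`(x', y')`, provided that `px ≤ x'`. -/
theorem circle_point_not_above_line {ρ px py x y x' y' : ℝ} (hp : px ^ 2 + py ^ 2 < ρ ^ 2)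
    (hpx : px < x) (hx : 0 < x) (hq : x ^ 2 + y ^ 2 = ρ ^ 2) (hx' : 0 < x')
    (hq' : x' ^ 2 + y' ^ 2 = ρ ^ 2) (hpx' : px ≤ x') (hy : y' < y) :
    (x - px) * (y' - py) - (y - py) * (x' - px) ≤ 0 := by
  rcases le_or_gt x' x with h | h
  · have hy' : y' < 0 := by
      by_contra hc
      push Not at hc
      nlinarith
    -- The segment from (px, py) to (x, y) stays in the disk. Its point at abscissa x' is therefore
    -- not below (x', y'), which is on the lower arc.
    obtain ⟨k, hk⟩ : ∃ k, k * (x - px) = x' - px :=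
      ⟨(x' - px) / (x - px), div_mul_cancel₀ _ (by linarith)⟩
    have hk0 : 0 ≤ k := by
      by_contra hc
      nlinarith
    have hk1 : k ≤ 1 := by
      by_contra hc
      nlinarith
    have hxk : x' = (1 - k) * px + k * x := by linarith
    have hconv : x' ^ 2 + ((1 - k) * py + k * y) ^ 2 ≤ ρ ^ 2 := by
      have h1 : (1 - k) * (px ^ 2 + py ^ 2) + k * (x ^ 2 + y ^ 2) ≤ ρ ^ 2 := by nlinarith
      have h2 : 0 ≤ k * (1 - k) * ((x - px) ^ 2 + (y - py) ^ 2) := by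
        have : 0 ≤ 1 - k := by linarith
        positivity
      rw [hxk]
      nlinarith
    have hle : y' ≤ (1 - k) * py + k * y := by
      by_contra hc
      nlinarith
    rw [← hk]
    nlinarith [mul_le_mul_of_nonneg_left hle (sub_pos.2 hpx).le]
  · have hy0 : 0 < y := by
      by_contra hc
      nlinarith
    -- The line leaves the disk at (x, y), so its direction has positive product with the outward
    -- normal. With Cauchy–Schwarz this settles the sign after multiplication by y > 0.
    have hexit : 0 < (x - px) * x + (y - py) * y := by
      nlinarith [sq_nonneg (x - px), sq_nonneg (y - py)]
    have hcs : x * x' + y * y' ≤ ρ ^ 2 := by nlinarith [sq_nonneg (x - x'), sq_nonneg (y - y')]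
    have h1 : y * ((x - px) * (y' - py) - (y - py) * (x' - px))
        = (x - px) * (x * x' + y * y' - (x ^ 2 + y ^ 2))
          - ((x - px) * x + (y - py) * y) * (x' - x) := by ring
    have h2 : (x - px) * (x * x' + y * y' - (x ^ 2 + y ^ 2)) ≤ 0 :=
      mul_nonpos_of_nonneg_of_nonpos (by linarith) (by linarith)
    have h3 : 0 < ((x - px) * x + (y - py) * y) * (x' - x) := mul_pos hexit (by linarith)
    by_contra hc
    nlinarith

/-- Two rays, given by their apices and directions in coordinates, have no common point. -/
def CoordDisjoint (px py c d bx bY c' d' : ℝ) : Prop :=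
  ∀ a ≥ 0, ∀ b ≥ 0, px + a * c = bx + b * c' → py + a * d ≠ bY + b * d'

theorem CoordDisjoint.neg_snd {px py c d bx bY c' d' : ℝ}
    (h : CoordDisjoint px py c d bx bY c' d') :
    CoordDisjoint px (-py) c (-d) bx (-bY) c' (-d') :=
  fun a ha b hb h1 h2 => h a ha b hb h1 (by linarith)

/-- A ray that starts to the right of the apex of a disjoint one does not meet its line. -/
theorem CoordDisjoint.line_ne {px py c d bx bY c' d' : ℝ}
    (h : CoordDisjoint px py c d bx bY c' d') (hc : 0 < c) (hc' : 0 ≤ c') (hb : px ≤ bx) {a : ℝ}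
    (ha : 0 ≤ a) : c * (bY + a * d' - py) - d * (bx + a * c' - px) ≠ 0 := by
  intro h0
  refine h ((bx + a * c' - px) / c) ?_ a ha ?_ ?_
  · have := mul_nonneg ha hc'
    exact div_nonneg (by linarith) hc.le
  · field_simp
    ring
  · field_simp
    linarith

/-- Where it meets the circle, the second ray is not above the line of the first, by
`circle_point_not_above_line`. It never meets that line, by `line_ne`, so by continuity its apex is
strictly below as well. -/
theorem CoordDisjoint.below_line {px py c d bx bY c' d' ρ t t' : ℝ}
    (h : CoordDisjoint px py c d bx bY c' d') (hc : 0 < c) (hc' : 0 ≤ c') (hb : px ≤ bx)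
    (hp : px ^ 2 + py ^ 2 < ρ ^ 2) (ht : 0 ≤ t) (ht' : 0 ≤ t')
    (hx : 0 < px + t * c) (hq : (px + t * c) ^ 2 + (py + t * d) ^ 2 = ρ ^ 2)
    (hx' : 0 < bx + t' * c') (hq' : (bx + t' * c') ^ 2 + (bY + t' * d') ^ 2 = ρ ^ 2)
    (hy : bY + t' * d' < py + t * d) : c * (bY - py) - d * (bx - px) < 0 := by
  have ht0 : 0 < t := by
    rcases ht.eq_or_lt with rfl | h
    · norm_num at hq
      linarith
    · exact h
  have key := circle_point_not_above_line hp (by nlinarith) hx hq hx' hq'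
    (by nlinarith) hy
  have key' : c * (bY + t' * d' - py) - d * (bx + t' * c' - px) ≤ 0 := by
    by_contra hcon
    push Not at hcon
    nlinarith [mul_pos ht0 hcon]
  by_contra hcon
  push Not at hcon
  have hcont : ContinuousOn (fun a : ℝ => c * (bY + a * d' - py) - d * (bx + a * c' - px))
      (Set.Icc 0 t') := by fun_prop
  obtain ⟨a, ha, ha0⟩ := intermediate_value_Icc' ht' hcont (show (0 : ℝ) ∈ Set.Icc _ _ from
    ⟨key', by simpa using hcon⟩)
  exact h.line_ne hc hc' hb ha.1 ha0

theorem CoordDisjoint.above_line {px py c d bx bY c' d' ρ t t' : ℝ}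
    (h : CoordDisjoint px py c d bx bY c' d') (hc : 0 < c) (hc' : 0 ≤ c') (hb : px ≤ bx)
    (hp : px ^ 2 + py ^ 2 < ρ ^ 2) (ht : 0 ≤ t) (ht' : 0 ≤ t')
    (hx : 0 < px + t * c) (hq : (px + t * c) ^ 2 + (py + t * d) ^ 2 = ρ ^ 2)
    (hx' : 0 < bx + t' * c') (hq' : (bx + t' * c') ^ 2 + (bY + t' * d') ^ 2 = ρ ^ 2)
    (hy : py + t * d < bY + t' * d') : 0 < c * (bY - py) - d * (bx - px) := by
  have := h.neg_snd.below_line (ρ := ρ) (t := t) (t' := t') hc hc' hb (by linarith) ht ht' hx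
    (by rw [← hq]; ring) hx' (by rw [← hq']; ring) (by linarith)
  linarith

/-- Of two disjoint rays that run to the right, the lower one is not steeper. -/
theorem CoordDisjoint.slope_le {px py c d bx bY c' d' : ℝ}
    (h : CoordDisjoint px py c d bx bY c' d') (hc : 0 < c) (hc' : 0 < c') (hb : px ≤ bx)
    (hlow : c * (bY - py) - d * (bx - px) < 0) : d' / c' ≤ d / c := by
  rw [div_le_div_iff₀ hc' hc]
  by_contra hcon
  push Not at hcon
  have hpos : 0 < d' * c - d * c' := by linarith
  -- If the lower ray were steeper, it would reach the line of the upper one at this nonnegative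
  -- parameter, against `line_ne`.
  have ha := div_mul_cancel₀ (-(c * (bY - py) - d * (bx - px))) hpos.ne'
  refine h.line_ne hc hc'.le hb (div_nonneg (by linarith) hpos.le) (?_ :
    c * (bY + -(c * (bY - py) - d * (bx - px)) / (d' * c - d * c') * d' - py) -
      d * (bx + -(c * (bY - py) - d * (bx - px)) / (d' * c - d * c') * c' - px) = 0)
  linear_combination ha

theorem CoordDisjoint.le_slope {px py c d bx bY c' d' : ℝ}
    (h : CoordDisjoint px py c d bx bY c' d') (hc : 0 < c) (hc' : 0 < c') (hb : px ≤ bx)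
    (hlow : 0 < c * (bY - py) - d * (bx - px)) : d / c ≤ d' / c' := by
  have := h.neg_snd.slope_le hc hc' hb (by linarith)
  rw [neg_div, neg_div] at this
  linarith

/-- Two lines through points near `x = -1` that both pass between two points near `x = 1`, the
first line being above the second one to the right of their base points, force the two points to be
about as far apart as the base points. -/
theorem gap_lt_of_lines_between {e Y x₁ y₁ x₂ y₂ u₀ w₀ u₁ w₁ s₁ s₂ : ℝ}
    (heY : e * Y ≤ 1 / 4) (hx₁ : x₁ ∈ Set.Icc (-1 - e) (-1)) (hx₂ : x₂ ∈ Set.Icc (-1 - e) (-1))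
    (hu₀ : u₀ ∈ Set.Icc 1 (1 + e)) (hu₁ : u₁ ∈ Set.Icc 1 (1 + e))
    (h01 : |w₀ - y₁| ≤ Y) (h11 : |w₁ - y₁| ≤ Y) (h12 : |w₁ - y₂| ≤ Y)
    (l01 : y₁ + s₁ * (u₀ - x₁) < w₀) (l02 : y₂ + s₂ * (u₀ - x₂) < w₀)
    (l11 : w₁ < y₁ + s₁ * (u₁ - x₁)) (l12 : w₁ < y₂ + s₂ * (u₁ - x₂)) (hs : s₂ ≤ s₁)
    (hbase : (x₁ ≤ x₂ ∧ y₂ < y₁ + s₁ * (x₂ - x₁)) ∨ (x₂ ≤ x₁ ∧ y₂ + s₂ * (x₁ - x₂) < y₁)) :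
    |y₁ - y₂| < w₀ - w₁ + 1 / 2 := by
  obtain ⟨a1, a2⟩ := hx₁
  obtain ⟨a3, a4⟩ := hx₂
  obtain ⟨a5, a6⟩ := hu₀
  obtain ⟨a7, a8⟩ := hu₁
  rw [abs_le] at h01 h11 h12
  -- The lines cover a horizontal distance of at least 2 while the height changes by at most `Y`;
  -- the upper bound for `s₂` comes from `s₂ ≤ s₁`.
  have hs1 : |s₁| ≤ Y / 2 := by
    rw [abs_le]; constructor
    · by_contra hc; nlinarith
    · by_contra hc; nlinarith
  have hs2 : |s₂| ≤ Y / 2 := by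
    rw [abs_le]; constructor
    · by_contra hc; nlinarith
    · by_contra hc; nlinarith
  -- Moving horizontally within a strip of width `e` changes heights on the lines by at most e·Y/2 ≤
  -- 1/8, so each strip acts as a vertical line.
  have small : ∀ s z : ℝ, |s| ≤ Y / 2 → |z| ≤ e → |s * z| ≤ 1 / 8 := by
    intro s z h1 h2
    rw [abs_mul]
    nlinarith [abs_nonneg s, abs_nonneg z, mul_le_mul h1 h2 (abs_nonneg z)
      ((abs_nonneg s).trans h1)]
  have b1 := abs_le.1 (small s₁ (x₂ - x₁) hs1 (abs_le.2 ⟨by linarith, by linarith⟩))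
  have b2 := abs_le.1 (small s₂ (x₁ - x₂) hs2 (abs_le.2 ⟨by linarith, by linarith⟩))
  have b3 := abs_le.1 (small s₂ (u₀ - u₁) hs2 (abs_le.2 ⟨by linarith, by linarith⟩))
  have hy : -(1 / 8) < y₁ - y₂ := by
    rcases hbase with ⟨-, h⟩ | ⟨-, h⟩ <;> linarith
  -- The vertical gap between the lines does not shrink to the right, since `s₂ ≤ s₁`. Two
  -- displacements inside the strips cost 1/8 each.
  have hgap : y₁ - y₂ - 1 / 4 < w₀ - w₁ := by
    rcases le_total x₁ x₂ with h | h
    · nlinarith [mul_nonneg (sub_nonneg.2 hs) (show 0 ≤ u₀ - x₂ by linarith)]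
    · nlinarith [mul_nonneg (sub_nonneg.2 hs) (show 0 ≤ u₀ - x₁ by linarith)]
  rw [abs_lt]
  constructor <;> linarith

/-! ### Rays leaving through one half circle -/

/-- Disjoint rays with apices `(X p, Y p)` and directions `(C p, D p)`, meeting the right half of
the circle of radius `ρ`, and listed in clockwise order. -/
structure RayBlock {α : Type*} (ρ : ℝ) (X Y C D t : α → ℝ) (L : List α) : Prop where
  apex_mem : ∀ p ∈ L, X p ^ 2 + Y p ^ 2 < ρ ^ 2
  time_nonneg : ∀ p ∈ L, 0 ≤ t p
  dir_nonneg : ∀ p ∈ L, 0 ≤ C p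
  right : ∀ p ∈ L, 0 < X p + t p * C p
  circle : ∀ p ∈ L, (X p + t p * C p) ^ 2 + (Y p + t p * D p) ^ 2 = ρ ^ 2
  disjoint : ∀ p ∈ L, ∀ q ∈ L, p ≠ q →
    CoordDisjoint (X p) (Y p) (C p) (D p) (X q) (Y q) (C q) (D q)
  clockwise : L.Pairwise fun p q => Y q + t q * D q < Y p + t p * D p

namespace RayBlock

variable {α : Type*} {ρ : ℝ} {X Y C D t : α → ℝ} {L : List α}

theorem dir_pos (h : RayBlock ρ X Y C D t L) {p : α} (hp : p ∈ L) (hX : X p < 0) : 0 < C p := by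
  have h1 := h.right p hp
  have h2 := h.time_nonneg p hp
  by_contra hc
  nlinarith

theorem below_line (h : RayBlock ρ X Y C D t L) {p b : α} (hp : p ∈ L) (hb : b ∈ L)
    (hX : X p < 0) (hle : X p ≤ X b) (hlt : Y b + t b * D b < Y p + t p * D p) :
    Y b < Y p + D p / C p * (X b - X p) := by
  have hne : p ≠ b := by rintro rfl; exact lt_irrefl _ hlt
  have hc := h.dir_pos hp hX
  have := (h.disjoint p hp b hb hne).below_line hc (h.dir_nonneg b hb) hle (h.apex_mem p hp)
    (h.time_nonneg p hp) (h.time_nonneg b hb) (h.right p hp) (h.circle p hp) (h.right b hb)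
    (h.circle b hb) hlt
  have h2 : C p * (Y p + D p / C p * (X b - X p) - Y b) =
      -(C p * (Y b - Y p) - D p * (X b - X p)) := by field_simp; ring
  have h3 : 0 < C p * (Y p + D p / C p * (X b - X p) - Y b) := by linarith
  linarith [(mul_pos_iff_of_pos_left hc).1 h3]

theorem above_line (h : RayBlock ρ X Y C D t L) {p b : α} (hp : p ∈ L) (hb : b ∈ L)
    (hX : X p < 0) (hle : X p ≤ X b) (hlt : Y p + t p * D p < Y b + t b * D b) :
    Y p + D p / C p * (X b - X p) < Y b := by
  have hne : p ≠ b := by rintro rfl; exact lt_irrefl _ hlt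
  have hc := h.dir_pos hp hX
  have := (h.disjoint p hp b hb hne).above_line hc (h.dir_nonneg b hb) hle (h.apex_mem p hp)
    (h.time_nonneg p hp) (h.time_nonneg b hb) (h.right p hp) (h.circle p hp) (h.right b hb)
    (h.circle b hb) hlt
  have h2 : C p * (Y b - (Y p + D p / C p * (X b - X p))) =
      C p * (Y b - Y p) - D p * (X b - X p) := by field_simp; ring
  have h3 : 0 < C p * (Y b - (Y p + D p / C p * (X b - X p))) := by linarith
  linarith [(mul_pos_iff_of_pos_left hc).1 h3]

theorem lt_of_getElem (h : RayBlock ρ X Y C D t L) {i j : ℕ} (hi : i < L.length)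
    (hj : j < L.length) (hij : i < j) :
    Y L[j] + t L[j] * D L[j] < Y L[i] + t L[i] * D L[i] :=
  List.pairwise_iff_getElem.1 h.clockwise i j hi hj hij

theorem slope_le (h : RayBlock ρ X Y C D t L) {p q : α} (hp : p ∈ L) (hq : q ∈ L)
    (hXp : X p < 0) (hXq : X q < 0) (hlt : Y q + t q * D q < Y p + t p * D p) :
    D q / C q ≤ D p / C p := by
  have hne : p ≠ q := by rintro rfl; exact lt_irrefl _ hlt
  have hp0 := h.dir_pos hp hXp
  have hq0 := h.dir_pos hq hXq
  rcases le_total (X p) (X q) with hle | hle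
  · refine (h.disjoint p hp q hq hne).slope_le hp0 hq0 hle ?_
    exact (h.disjoint p hp q hq hne).below_line hp0 (h.dir_nonneg q hq) hle (h.apex_mem p hp)
      (h.time_nonneg p hp) (h.time_nonneg q hq) (h.right p hp) (h.circle p hp) (h.right q hq)
      (h.circle q hq) hlt
  · refine (h.disjoint q hq p hp hne.symm).le_slope hq0 hp0 hle ?_
    exact (h.disjoint q hq p hp hne.symm).above_line hq0 (h.dir_nonneg p hp) hle (h.apex_mem q hq)
      (h.time_nonneg q hq) (h.time_nonneg p hp) (h.right q hq) (h.circle q hq) (h.right p hp)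
      (h.circle p hp) hlt

/-- If two rays from points on the left separate two points on the right at infinity, then the
points on the right are about as far apart as those on the left. -/
theorem gap_lt (h : RayBlock ρ X Y C D t L) {e H : ℝ} (heH : e * H ≤ 1 / 4)
    (hH : ∀ p ∈ L, ∀ q ∈ L, |Y p - Y q| ≤ H)
    {i j k l : ℕ} (hij : i < j) (hjk : j < k) (hkl : k < l) (hl : l < L.length)
    (hi' : X L[i] ∈ Set.Icc 1 (1 + e)) (hj' : X L[j] ∈ Set.Icc (-1 - e) (-1))
    (hk' : X L[k] ∈ Set.Icc (-1 - e) (-1)) (hl' : X L[l] ∈ Set.Icc 1 (1 + e)) :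
    |Y L[j] - Y L[k]| < Y L[i] - Y L[l] + 1 / 2 := by
  have hm : ∀ n (hn : n < L.length), L[n] ∈ L := fun n hn => List.getElem_mem hn
  have hj0 : X L[j] < 0 := by have := hj'.2; linarith
  have hk0 : X L[k] < 0 := by have := hk'.2; linarith
  have hji : X L[j] ≤ X L[i] := by have := hi'.1; linarith
  have hki : X L[k] ≤ X L[i] := by have := hi'.1; linarith
  have hjl : X L[j] ≤ X L[l] := by have := hl'.1; linarith
  have hkl' : X L[k] ≤ X L[l] := by have := hl'.1; linarith
  refine gap_lt_of_lines_between heH hj' hk' hi' hl' (hH _ (hm _ _) _ (hm _ _))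
    (hH _ (hm _ _) _ (hm _ _)) (hH _ (hm _ _) _ (hm _ _))
    (h.above_line (hm _ _) (hm _ _) hj0 hji (h.lt_of_getElem _ _ (by omega)))
    (h.above_line (hm _ _) (hm _ _) hk0 hki (h.lt_of_getElem _ _ (by omega)))
    (h.below_line (hm _ _) (hm _ _) hj0 hjl (h.lt_of_getElem _ _ (by omega)))
    (h.below_line (hm _ _) (hm _ _) hk0 hkl' (h.lt_of_getElem _ _ (by omega)))
    (h.slope_le (hm _ _) (hm _ _) hj0 hk0 (h.lt_of_getElem _ _ (by omega))) ?_
  rcases le_total (X L[j]) (X L[k]) with hle | hle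
  · exact Or.inl ⟨hle, h.below_line (hm _ _) (hm _ _) hj0 hle (h.lt_of_getElem _ _ (by omega))⟩
  · exact Or.inr ⟨hle, h.above_line (hm _ _) (hm _ _) hk0 hle (h.lt_of_getElem _ _ (by omega))⟩

end RayBlock

/-! ### Alternating lists and the pigeonhole principle -/

theorem chain_ne_getElem_succ {α : Type*} {col : α → Bool} {L : List α}
    (h : L.IsChain fun p q => col p ≠ col q) {i : ℕ} (hi : i + 1 < L.length) :
    col L[i + 1] = !col L[i] := by
  have := List.isChain_iff_getElem.1 h i hi
  revert this
  cases col L[i] <;> cases col L[i + 1] <;> simp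

theorem chain_ne_getElem_add {α : Type*} {col : α → Bool} {L : List α}
    (h : L.IsChain fun p q => col p ≠ col q) {i : ℕ} (k : ℕ) (hi : i + 2 * k < L.length) :
    col L[i + 2 * k] = col L[i] := by
  induction k with
  | zero => rfl
  | succ k ih =>
    have h1 := chain_ne_getElem_succ h (i := i + 2 * k) (by omega)
    have h2 := chain_ne_getElem_succ h (i := i + 2 * k + 1) (by omega)
    rw [h1, Bool.not_not, ih (by omega)] at h2
    exact h2

theorem exists_start_of_chain_ne {α : Type*} {col : α → Bool} {L : List α}
    (h : L.IsChain fun p q => col p ≠ col q) (c : Bool) (hL : 2 ≤ L.length) :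
    ∃ s, s ≤ 1 ∧ (∀ i (hi : s + 2 * i < L.length), col L[s + 2 * i] = c) ∧
      ∀ i (hi : s + 1 + 2 * i < L.length), col L[s + 1 + 2 * i] = !c := by
  obtain ⟨s, hs, hs', hc⟩ : ∃ s, s ≤ 1 ∧ ∃ hs : s < L.length, col L[s] = c := by
    by_cases h0 : col L[0] = c
    · exact ⟨0, by omega, by omega, h0⟩
    · refine ⟨1, le_rfl, by omega, ?_⟩
      have := chain_ne_getElem_succ h (i := 0) (by omega)
      simp only [zero_add] at this
      rw [this]
      revert h0
      cases col L[0] <;> cases c <;> simp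
  refine ⟨s, hs, fun i hi => (chain_ne_getElem_add h i hi).trans hc, fun i hi => ?_⟩
  rw [chain_ne_getElem_add h i hi, chain_ne_getElem_succ h (by omega), hc]

theorem exists_lt_eq_of_bounded (m : ℕ) (f : ℕ → ℕ) (hf : ∀ i ≤ m, f i < m) :
    ∃ i j, i < j ∧ j ≤ m ∧ f i = f j := by
  obtain ⟨i, hi, j, hj, hne, hij⟩ := Finset.exists_ne_map_eq_of_card_lt_of_maps_to
    (s := Finset.range (m + 1)) (t := Finset.range m) (by simp) (f := f)
    (fun i hi => by simpa using hf i (by simpa [Nat.lt_succ_iff] using hi))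
  simp only [Finset.mem_range] at hi hj
  rcases hne.lt_or_gt with h | h
  · exact ⟨i, j, h, by omega, hij⟩
  · exact ⟨j, i, h, by omega, hij.symm⟩

/-! ### Bounds for the alternations in one block -/

namespace RayBlock

variable {α : Type*} {ρ : ℝ} {X Y C D t : α → ℝ} {L : List α}

/-- The points on the right lie in `m` narrow clusters, those on the left are well separated. -/
theorem length_le_of_clusters_right (h : RayBlock ρ X Y C D t L) {e H : ℝ} (heH : e * H ≤ 1 / 4)
    (hH : ∀ p ∈ L, ∀ q ∈ L, |Y p - Y q| ≤ H) {col : α → Bool} {c : Bool}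
    (hchain : L.IsChain fun p q => col p ≠ col q)
    (hright : ∀ p ∈ L, col p = c → X p ∈ Set.Icc 1 (1 + e))
    (hleft : ∀ p ∈ L, col p = !c → X p ∈ Set.Icc (-1 - e) (-1))
    (hsep : ∀ p ∈ L, ∀ q ∈ L, p ≠ q → col p = !c → col q = !c → 1 ≤ |Y p - Y q|)
    (m : ℕ) (k : α → ℕ) (hk : ∀ p ∈ L, col p = c → k p < m)
    (hcl : ∀ p ∈ L, ∀ q ∈ L, col p = c → col q = c → k p = k q → |Y p - Y q| ≤ 1 / 4) :
    L.length ≤ 4 * m + 1 := by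
  by_contra hlen
  push Not at hlen
  obtain ⟨s, hs, hs0, hs1⟩ := exists_start_of_chain_ne hchain c (by omega)
  have hm : ∀ n (hn : n < L.length), L[n] ∈ L := fun n hn => List.getElem_mem hn
  -- Only every second entry of colour `c` is sampled, so two sampled entries in the same cluster
  -- have at least two entries of the other colour between them.
  obtain ⟨i, j, hij, hj, hkij⟩ := exists_lt_eq_of_bounded m
    (fun i => if hi : s + 2 * (2 * i) < L.length then k L[s + 2 * (2 * i)] else 0) (by
      intro i hi
      have hi' : s + 2 * (2 * i) < L.length := by omega
      simp only [hi', dif_pos]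
      exact hk _ (hm _ _) (hs0 _ hi'))
  have hi' : s + 2 * (2 * i) < L.length := by omega
  have hj' : s + 2 * (2 * j) < L.length := by omega
  simp only [hi', hj', dif_pos] at hkij
  have h1 : s + 1 + 2 * (2 * i) < L.length := by omega
  have h2 : s + 1 + 2 * (2 * i + 1) < L.length := by omega
  have hgap := h.gap_lt heH hH (i := s + 2 * (2 * i)) (j := s + 1 + 2 * (2 * i))
    (k := s + 1 + 2 * (2 * i + 1)) (l := s + 2 * (2 * j)) (by omega) (by omega) (by omega) hj'
    (hright _ (hm _ _) (hs0 _ _)) (hleft _ (hm _ _) (hs1 _ _)) (hleft _ (hm _ _) (hs1 _ _))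
    (hright _ (hm _ _) (hs0 _ _))
  have hne : L[s + 1 + 2 * (2 * i)] ≠ L[s + 1 + 2 * (2 * i + 1)] := fun heq => by
    have := h.lt_of_getElem h1 h2 (by omega)
    rw [heq] at this
    exact lt_irrefl _ this
  -- The contradiction is 1 ≤ gap < 1/4 + 1/2.
  have hbig := hsep _ (hm _ _) _ (hm _ _) hne (hs1 _ h1) (hs1 _ h2)
  have hsmall := (abs_le.1 (hcl _ (hm _ _) _ (hm _ _) (hs0 _ hi') (hs0 _ hj') hkij)).2
  linarith

/-- The points on the left lie in clusters of at most `m` points that are farther apart than the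
points on the right. -/
theorem length_le_of_clusters_left (h : RayBlock ρ X Y C D t L) {e H N : ℝ} (heH : e * H ≤ 1 / 4)
    (hH : ∀ p ∈ L, ∀ q ∈ L, |Y p - Y q| ≤ H) {col : α → Bool} {c : Bool}
    (hchain : L.IsChain fun p q => col p ≠ col q)
    (hright : ∀ p ∈ L, col p = c → X p ∈ Set.Icc 1 (1 + e))
    (hleft : ∀ p ∈ L, col p = !c → X p ∈ Set.Icc (-1 - e) (-1))
    (hclose : ∀ p ∈ L, ∀ q ∈ L, col p = c → col q = c → |Y p - Y q| ≤ N)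
    (m : ℕ) (k g : α → ℕ) (hg : ∀ p ∈ L, col p = !c → g p < m)
    (hcl : ∀ p ∈ L, ∀ q ∈ L, col p = !c → col q = !c → k p ≠ k q → N + 1 ≤ |Y p - Y q|)
    (hinj : ∀ p ∈ L, ∀ q ∈ L, col p = !c → col q = !c → k p = k q → g p = g q → p = q) :
    L.length ≤ 2 * m + 3 := by
  by_contra hlen
  push Not at hlen
  obtain ⟨s, hs, hs0, hs1⟩ := exists_start_of_chain_ne hchain c (by omega)
  have hm : ∀ n (hn : n < L.length), L[n] ∈ L := fun n hn => List.getElem_mem hn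
  -- The pigeonholes are positions inside a cluster: two different points with the same position lie
  -- in different clusters, giving N + 1 ≤ gap < N + 1/2. The entries of colour `c` just outside the
  -- pair serve as the two right points.
  obtain ⟨i, j, hij, hj, hkij⟩ := exists_lt_eq_of_bounded m
    (fun i => if hi : s + 1 + 2 * i < L.length then g L[s + 1 + 2 * i] else 0) (by
      intro i hi
      have hi' : s + 1 + 2 * i < L.length := by omega
      simp only [hi', dif_pos]
      exact hg _ (hm _ _) (hs1 _ hi'))
  have hi' : s + 1 + 2 * i < L.length := by omega
  have hj' : s + 1 + 2 * j < L.length := by omega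
  simp only [hi', hj', dif_pos] at hkij
  have h1 : s + 2 * i < L.length := by omega
  have h2 : s + 2 * (j + 1) < L.length := by omega
  have hgap := h.gap_lt heH hH (i := s + 2 * i) (j := s + 1 + 2 * i)
    (k := s + 1 + 2 * j) (l := s + 2 * (j + 1)) (by omega) (by omega) (by omega) h2
    (hright _ (hm _ _) (hs0 _ _)) (hleft _ (hm _ _) (hs1 _ _)) (hleft _ (hm _ _) (hs1 _ _))
    (hright _ (hm _ _) (hs0 _ _))
  have hne : L[s + 1 + 2 * i] ≠ L[s + 1 + 2 * j] := fun heq => by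
    have := h.lt_of_getElem hi' hj' (by omega)
    rw [heq] at this
    exact lt_irrefl _ this
  have hsmall := (abs_le.1 (hclose _ (hm _ _) _ (hm _ _) (hs0 _ h1) (hs0 _ h2))).2
  have hkne : k L[s + 1 + 2 * i] ≠ k L[s + 1 + 2 * j] := fun hk =>
    hne (hinj _ (hm _ _) _ (hm _ _) (hs1 _ hi') (hs1 _ hj') hk hkij)
  have hbig := hcl _ (hm _ _) _ (hm _ _) (hs1 _ hi') (hs1 _ hj') hkne
  linarith

end RayBlock

/-! ### Two opposite parabolas and general position -/

/-- The point at height `y` on the parabola `x = σ (1 + η y²)`. -/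
noncomputable def parabolaPoint (η σ y : ℝ) : Plane := !₂[σ * (1 + η * y ^ 2), y]

@[simp] theorem parabolaPoint_zero (η σ y : ℝ) :
    parabolaPoint η σ y 0 = σ * (1 + η * y ^ 2) := by simp [parabolaPoint]

@[simp] theorem parabolaPoint_one (η σ y : ℝ) : parabolaPoint η σ y 1 = y := by
  simp [parabolaPoint]

theorem Collinear.det_eq_zero {p q r : Plane} (h : Collinear ℝ ({p, q, r} : Set Plane)) :
    (q 0 - p 0) * (r 1 - p 1) - (q 1 - p 1) * (r 0 - p 0) = 0 := by
  obtain ⟨v, hv⟩ := (collinear_iff_of_mem (p₀ := p) (by simp)).1 h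
  obtain ⟨a, ha⟩ := hv q (by simp)
  obtain ⟨b, hb⟩ := hv r (by simp)
  subst ha hb
  simp
  ring

/-- For three points on one arc the determinant is a Vandermonde product. With the third point on
the opposite arc it is `b - a` times a factor that `η * H ^ 2 < 2` keeps positive. -/
theorem not_collinear_parabolaPoint_of_eq {η σ τ a b c H : ℝ} (hη : 0 < η) (hηH : η * H ^ 2 < 2)
    (hσ : σ = 1 ∨ σ = -1) (hτ : τ = 1 ∨ τ = -1) (ha : a ∈ Set.Icc 0 H) (hb : b ∈ Set.Icc 0 H)
    (hc : c ∈ Set.Icc 0 H) (hab : parabolaPoint η σ a ≠ parabolaPoint η σ b)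
    (hbc : parabolaPoint η σ b ≠ parabolaPoint η τ c)
    (hac : parabolaPoint η σ a ≠ parabolaPoint η τ c) :
    ¬ Collinear ℝ
      ({parabolaPoint η σ a, parabolaPoint η σ b, parabolaPoint η τ c} : Set Plane) := by
  intro h
  have h0 := h.det_eq_zero
  simp only [parabolaPoint_zero, parabolaPoint_one] at h0
  have hab' : b - a ≠ 0 := fun hh => hab (by rw [sub_eq_zero.1 hh])
  have hσ0 : σ ≠ 0 := by rcases hσ with rfl | rfl <;> norm_num
  by_cases hστ : σ = τ
  · subst hστ
    have hbc' : b - c ≠ 0 := fun hh => hbc (by rw [sub_eq_zero.1 hh])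
    have hac' : c - a ≠ 0 := fun hh => hac (by rw [sub_eq_zero.1 hh])
    have : σ * η * (b - a) * (c - a) * (b - c) = 0 := by linear_combination h0
    simp_all [hη.ne']
  · have hτσ : τ = -σ := by
      rcases hσ with rfl | rfl <;> rcases hτ with rfl | rfl <;> simp_all
    subst hτσ
    have h1 : σ * (b - a) * (2 + η * (b * c + a * c + c ^ 2 - a * b)) = 0 := by
      linear_combination h0
    have h2 : 0 < 2 + η * (b * c + a * c + c ^ 2 - a * b) := by
      have e1 : a * b ≤ H ^ 2 := by nlinarith [ha.1, ha.2, hb.1, hb.2]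
      have e2 : 0 ≤ b * c + a * c + c ^ 2 := by
        nlinarith [ha.1, hb.1, hc.1, mul_nonneg hb.1 hc.1, mul_nonneg ha.1 hc.1]
      nlinarith [mul_le_mul_of_nonneg_left e1 hη.le, mul_nonneg hη.le e2]
    simp_all [h2.ne']

/-- Of three points on two arcs, two share an arc, so a permutation reduces to the previous case. -/
theorem not_collinear_parabolaPoint {η σ₁ σ₂ σ₃ a b c H : ℝ} (hη : 0 < η) (hηH : η * H ^ 2 < 2)
    (h₁ : σ₁ = 1 ∨ σ₁ = -1) (h₂ : σ₂ = 1 ∨ σ₂ = -1) (h₃ : σ₃ = 1 ∨ σ₃ = -1)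
    (ha : a ∈ Set.Icc 0 H) (hb : b ∈ Set.Icc 0 H) (hc : c ∈ Set.Icc 0 H)
    (hab : parabolaPoint η σ₁ a ≠ parabolaPoint η σ₂ b)
    (hbc : parabolaPoint η σ₂ b ≠ parabolaPoint η σ₃ c)
    (hac : parabolaPoint η σ₁ a ≠ parabolaPoint η σ₃ c) :
    ¬ Collinear ℝ
      ({parabolaPoint η σ₁ a, parabolaPoint η σ₂ b, parabolaPoint η σ₃ c} : Set Plane) := by
  by_cases h12 : σ₁ = σ₂
  · subst h12
    exact not_collinear_parabolaPoint_of_eq hη hηH h₁ h₃ ha hb hc hab hbc hac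
  by_cases h13 : σ₁ = σ₃
  · subst h13
    rw [Set.pair_comm]
    exact not_collinear_parabolaPoint_of_eq hη hηH h₁ h₂ ha hc hb hac hbc.symm hab
  · have h23 : σ₂ = σ₃ := by
      rcases h₁ with rfl | rfl <;> rcases h₂ with rfl | rfl <;> rcases h₃ with rfl | rfl <;>
        simp_all
    subst h23
    rw [Set.insert_comm, Set.pair_comm]
    exact not_collinear_parabolaPoint_of_eq hη hηH h₂ h₁ hb hc ha hbc hac.symm hab.symm

/-! ### The clustered point set -/

/-- The number of clusters, which is also a bound for their size. -/
def clusterCount (n : ℕ) : ℕ := n.sqrt + 1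

/-- The height of the `j`-th blue point: `n` points in clusters of `clusterCount n` points, of
height less than `1 / 4` and at distance more than `n + 1` from each other. -/
noncomputable def blueHeight (n j : ℕ) : ℝ :=
  (n + 2) * (j / clusterCount n : ℕ) + (j % clusterCount n : ℕ) / (4 * clusterCount n)

/-- A bound for all heights that occur. -/
noncomputable def heightBound (n : ℕ) : ℝ := (n + 2) ^ 2

/-- The curvature parameter of the parabolas. -/
noncomputable def curvature (n : ℕ) : ℝ := 1 / (16 * heightBound n ^ 3)

theorem clusterCount_pos (n : ℕ) : 0 < clusterCount n := Nat.succ_pos _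

theorem lt_clusterCount_mul_self (n : ℕ) : n < clusterCount n * clusterCount n :=
  Nat.lt_succ_sqrt n

theorem one_le_heightBound (n : ℕ) : 1 ≤ heightBound n := by
  have : (0 : ℝ) ≤ n := n.cast_nonneg
  unfold heightBound; nlinarith

theorem curvature_pos (n : ℕ) : 0 < curvature n := by
  have := one_le_heightBound n
  unfold curvature; positivity

/-- The strips containing the arcs have width e = curvature · H², where H is `heightBound n`. The
value of `curvature` is chosen so that e · H = 1/16, within the bound 1/4 required by
`RayBlock.gap_lt`. -/
theorem curvature_mul_cube (n : ℕ) : curvature n * heightBound n ^ 3 = 1 / 16 := by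
  have := one_le_heightBound n
  unfold curvature; field_simp

theorem curvature_mul_sq_lt (n : ℕ) : curvature n * heightBound n ^ 2 < 2 := by
  have h1 := one_le_heightBound n
  have h2 := curvature_pos n
  have h3 := curvature_mul_cube n
  have : curvature n * heightBound n ^ 2 ≤ curvature n * heightBound n ^ 3 := by
    gcongr
    norm_num
  linarith

theorem offset_mem (n j : ℕ) :
    ((j % clusterCount n : ℕ) / (4 * clusterCount n) : ℝ) ∈ Set.Icc 0 (1 / 4) := by
  have hm : (0 : ℝ) < clusterCount n := by exact_mod_cast clusterCount_pos n
  have h : ((j % clusterCount n : ℕ) : ℝ) ≤ clusterCount n := by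
    exact_mod_cast (Nat.mod_lt _ (clusterCount_pos n)).le
  refine ⟨by positivity, ?_⟩
  rw [div_le_div_iff₀ (by positivity) (by norm_num)]
  linarith

theorem blueHeight_mem {n j : ℕ} (hj : j < n) : blueHeight n j ∈ Set.Icc 0 (heightBound n) := by
  obtain ⟨h1, h2⟩ := offset_mem n j
  have h3 : ((j / clusterCount n : ℕ) : ℝ) ≤ n := by
    exact_mod_cast (Nat.div_le_self _ _).trans hj.le
  have h4 : (0 : ℝ) ≤ n := n.cast_nonneg
  have h5 : (0 : ℝ) ≤ (j / clusterCount n : ℕ) := Nat.cast_nonneg _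
  unfold blueHeight heightBound
  constructor
  · positivity
  · nlinarith

theorem natCast_mem_heightBound {n i : ℕ} (hi : i < n) :
    (i : ℝ) ∈ Set.Icc 0 (heightBound n) := by
  have : (i : ℝ) ≤ n := by exact_mod_cast hi.le
  refine ⟨i.cast_nonneg, ?_⟩
  unfold heightBound; nlinarith [n.cast_nonneg (α := ℝ)]

theorem abs_blueHeight_sub_le {n i j : ℕ} (h : i / clusterCount n = j / clusterCount n) :
    |blueHeight n i - blueHeight n j| ≤ 1 / 4 := by
  obtain ⟨h1, h2⟩ := offset_mem n i
  obtain ⟨h3, h4⟩ := offset_mem n j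
  unfold blueHeight
  rw [h, abs_le]
  constructor <;> linarith

/-- Clusters are spaced by n + 2 and the offsets consume at most 1/4. What remains exceeds the red
height range, at most n, by the margin that `RayBlock.length_le_of_clusters_left` needs. -/
theorem le_abs_blueHeight_sub {n i j : ℕ} (h : i / clusterCount n ≠ j / clusterCount n) :
    (n : ℝ) + 1 ≤ |blueHeight n i - blueHeight n j| := by
  wlog hij : j / clusterCount n < i / clusterCount n generalizing i j
  · rw [abs_sub_comm]
    exact this h.symm (by omega)
  obtain ⟨h1, h2⟩ := offset_mem n i
  obtain ⟨h3, h4⟩ := offset_mem n j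
  have h5 : ((j / clusterCount n : ℕ) : ℝ) + 1 ≤ (i / clusterCount n : ℕ) := by exact_mod_cast hij
  refine le_trans ?_ (le_abs_self _)
  unfold blueHeight
  nlinarith [n.cast_nonneg (α := ℝ)]

theorem blueHeight_injective (n : ℕ) : Function.Injective (blueHeight n) := by
  intro i j hij
  by_cases h : i / clusterCount n = j / clusterCount n
  · unfold blueHeight at hij
    rw [h] at hij
    have hm : (0 : ℝ) < clusterCount n := by exact_mod_cast clusterCount_pos n
    have h1 : ((i % clusterCount n : ℕ) : ℝ) = (j % clusterCount n : ℕ) := by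
      have := add_left_cancel hij
      field_simp at this
      exact this
    have h2 : i % clusterCount n = j % clusterCount n := by exact_mod_cast h1
    rw [← Nat.div_add_mod i (clusterCount n), ← Nat.div_add_mod j (clusterCount n), h, h2]
  · have := le_abs_blueHeight_sub h
    rw [hij, sub_self, abs_zero] at this
    linarith [n.cast_nonneg (α := ℝ)]

noncomputable def redPoint (n i : ℕ) : Plane := parabolaPoint (curvature n) (-1) i

noncomputable def bluePoint (n j : ℕ) : Plane := parabolaPoint (curvature n) 1 (blueHeight n j)

theorem redPoint_injective (n : ℕ) : Function.Injective (redPoint n) := fun i j h => by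
  simpa [redPoint] using congrArg (fun p : Plane => p 1) h

theorem bluePoint_injective (n : ℕ) : Function.Injective (bluePoint n) := fun i j h =>
  blueHeight_injective n (by simpa [bluePoint] using congrArg (fun p : Plane => p 1) h)

theorem redPoint_ne_bluePoint (n i j : ℕ) : redPoint n i ≠ bluePoint n j := by
  intro h
  have := congrArg (fun p : Plane => p 0) h
  simp only [redPoint, bluePoint, parabolaPoint_zero] at this
  have h1 := curvature_pos n
  nlinarith [mul_nonneg h1.le (sq_nonneg (i : ℝ)), mul_nonneg h1.le (sq_nonneg (blueHeight n j))]

open Classical in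
/-- Red points on an almost vertical arc on the left, blue points in narrow, widely separated
clusters on an almost vertical arc on the right. -/
noncomputable def clusteredSet (n : ℕ) : BichromaticPointSet where
  red := (Finset.range n).image (redPoint n)
  blue := (Finset.range n).image (bluePoint n)
  disj := by
    rw [Finset.disjoint_left]
    intro p hp hq
    obtain ⟨i, -, rfl⟩ := Finset.mem_image.1 hp
    obtain ⟨j, -, h⟩ := Finset.mem_image.1 hq
    exact redPoint_ne_bluePoint n i j h.symm

theorem clusteredSet_isBalanced (n : ℕ) : (clusteredSet n).IsBalanced n := by
  constructor
  · simp [clusteredSet, Finset.card_image_of_injective _ (redPoint_injective n)]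
  · simp [clusteredSet, Finset.card_image_of_injective _ (bluePoint_injective n)]

theorem mem_red_clusteredSet {n : ℕ} {p : Plane} :
    p ∈ (clusteredSet n).red ↔ ∃ i < n, redPoint n i = p := by simp [clusteredSet]

theorem mem_blue_clusteredSet {n : ℕ} {p : Plane} :
    p ∈ (clusteredSet n).blue ↔ ∃ i < n, bluePoint n i = p := by simp [clusteredSet]

theorem exists_parabolaPoint_of_mem_points {n : ℕ} {p : Plane}
    (hp : p ∈ (clusteredSet n).points) :
    ∃ σ y : ℝ, (σ = 1 ∨ σ = -1) ∧ y ∈ Set.Icc 0 (heightBound n) ∧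
      p = parabolaPoint (curvature n) σ y := by
  rcases hp with h | h
  · obtain ⟨i, hi, rfl⟩ := mem_red_clusteredSet.1 h
    exact ⟨-1, i, Or.inr rfl, natCast_mem_heightBound hi, rfl⟩
  · obtain ⟨i, hi, rfl⟩ := mem_blue_clusteredSet.1 h
    exact ⟨1, blueHeight n i, Or.inl rfl, blueHeight_mem hi, rfl⟩

theorem clusteredSet_generalPosition (n : ℕ) : (clusteredSet n).GeneralPosition := by
  intro p hp q hq r hr hpq hqr hpr
  obtain ⟨σ₁, a, h₁, ha, rfl⟩ := exists_parabolaPoint_of_mem_points hp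
  obtain ⟨σ₂, b, h₂, hb, rfl⟩ := exists_parabolaPoint_of_mem_points hq
  obtain ⟨σ₃, c, h₃, hc, rfl⟩ := exists_parabolaPoint_of_mem_points hr
  exact not_collinear_parabolaPoint (curvature_pos n) (curvature_mul_sq_lt n) h₁ h₂ h₃ ha hb hc
    hpq hqr hpr

theorem curvature_mul_sq_mem {n : ℕ} {y : ℝ} (hy : y ∈ Set.Icc 0 (heightBound n)) :
    curvature n * y ^ 2 ∈ Set.Icc 0 (curvature n * heightBound n ^ 2) := by
  have := curvature_pos n
  obtain ⟨h1, h2⟩ := hy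
  constructor
  · positivity
  · gcongr

/-! ### Cutting the circle at infinity into half circles -/

/-- Each level set of a monotone function on a list is a contiguous segment; the induction strips
off the top level. Contiguity matters because alternation of colours passes to segments but not to
arbitrary sublists. -/
theorem length_le_of_antitone_blocks {α : Type*} (f : α → ℤ) (B n : ℕ) (κ : ℤ) (L : List α)
    (hanti : L.Pairwise fun p q => f q ≤ f p) (hrange : ∀ p ∈ L, κ ≤ f p ∧ f p < κ + n)
    (hB : ∀ L' : List α, L' <:+: L → (∀ c, (∀ p ∈ L', f p = c) → L'.length ≤ B)) :
    L.length ≤ n * B := by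
  induction n generalizing L with
  | zero =>
    obtain _ | ⟨x, L⟩ := L
    · simp
    · have := hrange x (by simp)
      simp at this
      omega
  | succ n ih =>
    set P : α → Bool := fun p => decide (f p = κ + n)
    have hL : L.takeWhile P ++ L.dropWhile P = L := List.takeWhile_append_dropWhile
    have h1 : (L.takeWhile P).length ≤ B := by
      refine hB _ (List.takeWhile_prefix P).isInfix (κ + n) fun p hp => ?_
      simpa [P] using List.mem_takeWhile_imp hp
    have h2 : (L.dropWhile P).length ≤ n * B := by
      have hsub := (List.dropWhile_sublist P (l := L))
      have hp := hanti.sublist hsub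
      refine ih _ hp (fun p hpm => ?_) fun L' hL' => hB L' (hL'.trans
        (List.dropWhile_suffix P).isInfix)
      have hr := hrange p (hsub.subset hpm)
      refine ⟨hr.1, ?_⟩
      have hne := List.head_dropWhile_not P (List.ne_nil_of_mem hpm)
      obtain ⟨x, L₂, hx⟩ := List.exists_cons_of_ne_nil (List.ne_nil_of_mem hpm)
      simp only [hx, List.head_cons] at hne
      have hx' := hrange x (hsub.subset (by simp [hx]))
      have hlt : f x < κ + n := by
        have : f x ≠ κ + n := by simpa [P] using hne
        push_cast at hx'
        omega
      rw [hx] at hp hpm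
      rcases List.mem_cons.1 hpm with rfl | hmem
      · exact hlt
      · exact (List.rel_of_pairwise_cons hp hmem).trans_lt hlt
    have h3 := congrArg List.length hL
    rw [List.length_append] at h3
    rw [Nat.succ_mul]
    omega

theorem norm_circlePoint {ρ : ℝ} (hρ : 0 ≤ ρ) (θ : ℝ) : ‖circlePoint ρ θ‖ = ρ := by
  rw [EuclideanSpace.norm_eq]
  simp only [circlePoint, Fin.sum_univ_two, Real.norm_eq_abs, sq_abs]
  have : (!₂[ρ * Real.cos θ, ρ * Real.sin θ] : Plane) 0 ^ 2 +
      (!₂[ρ * Real.cos θ, ρ * Real.sin θ] : Plane) 1 ^ 2 = ρ ^ 2 := by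
    simp
    nlinarith [Real.sin_sq_add_cos_sq θ]
  rw [this, Real.sqrt_sq hρ]

/-- A point of a ray far away from the origin is on the side to which the ray runs. -/
theorem dir_mul_pos_of_far {p v : Plane} {t ρ : ℝ} (hv : v 0 ≠ 0)
    (hρ : ‖p‖ + |p 0| / |v 0| * ‖v‖ < ρ) (ht : 0 ≤ t) (h : ‖p + t • v‖ = ρ) :
    0 < v 0 * (p 0 + t * v 0) := by
  by_contra hc
  push Not at hc
  have hv0 : 0 < |v 0| := abs_pos.2 hv
  have h1 : t * |v 0| ≤ |p 0| := by
    have h2 : t * |v 0| * |v 0| ≤ |p 0| * |v 0| := by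
      rw [mul_assoc, abs_mul_abs_self, ← abs_mul]
      have := neg_abs_le (p 0 * v 0)
      nlinarith
    exact le_of_mul_le_mul_right h2 hv0
  have h2 : t ≤ |p 0| / |v 0| := by rwa [le_div_iff₀ hv0]
  have h3 : ‖p + t • v‖ ≤ ‖p‖ + t * ‖v‖ := by
    refine (norm_add_le _ _).trans ?_
    rw [norm_smul, Real.norm_of_nonneg ht]
  have h4 : t * ‖v‖ ≤ |p 0| / |v 0| * ‖v‖ := by gcongr
  linarith

theorem BichromaticPointSet.finite_points (S : BichromaticPointSet) : S.points.Finite := by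
  refine (S.red.finite_toSet.union S.blue.finite_toSet).subset fun p hp => ?_
  rcases hp with h | h <;> simp [h]

theorem plane_norm_sq (p : Plane) : p 0 ^ 2 + p 1 ^ 2 = ‖p‖ ^ 2 := by
  rw [EuclideanSpace.real_norm_sq_eq, Fin.sum_univ_two]

/-- The points whose rays meet a large circle between two consecutive crossings of the vertical axis
form a block, after a rotation by `π` if necessary. -/
theorem rayBlock_of_floor_eq {S : BichromaticPointSet} {v : Plane → Plane}
    (hv : S.DisjointRays v) (hS : ∀ p ∈ S.points, p 0 ≠ 0) {ρ : ℝ}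
    (hρ : ∀ p ∈ S.points, ‖p‖ + |p 0| / |v p 0| * ‖v p‖ < ρ) {θ : Plane → ℝ} {c : ℤ} {ε : ℝ}
    (hε : ε = (-1) ^ c) {L : List Plane} (hL : ∀ p ∈ L, p ∈ S.points)
    (hray : ∀ p ∈ L, circlePoint ρ (θ p) ∈ ray p (v p))
    (hθ : L.Pairwise fun p q => θ q < θ p)
    (hc : ∀ p ∈ L, ⌊θ p / Real.pi + 1 / 2⌋ = c) :
    ∃ t : Plane → ℝ, RayBlock ρ (fun p => ε * p 0) (fun p => ε * p 1) (fun p => ε * v p 0)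
      (fun p => ε * v p 1) t L := by
  have hε2 : ε * ε = 1 := by
    rw [hε]
    rcases Int.even_or_odd c with h | h <;> simp [h.neg_one_zpow]
  have hε0 : ε ≠ 0 := fun h => by simp [h] at hε2
  have hρ0 : ∀ p ∈ L, ‖p‖ < ρ := fun p hp => by
    have h1 := hρ p (hL p hp)
    have h2 : 0 ≤ |p 0| / |v p 0| * ‖v p‖ := by positivity
    linarith
  have hray' : ∀ p, ∃ t : ℝ, p ∈ L → 0 ≤ t ∧ circlePoint ρ (θ p) = p + t • v p := fun p => by
    by_cases hp : p ∈ L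
    · obtain ⟨t, h⟩ := hray p hp
      exact ⟨t, fun _ => h⟩
    · exact ⟨0, fun h => absurd h hp⟩
  choose t ht using hray'
  have hcos : ∀ p ∈ L, p 0 + t p * v p 0 = ρ * Real.cos (θ p) := fun p hp => by
    have := congrArg (fun q : Plane => q 0) (ht p hp).2
    simpa [circlePoint] using this.symm
  have hsin : ∀ p ∈ L, p 1 + t p * v p 1 = ρ * Real.sin (θ p) := fun p hp => by
    have := congrArg (fun q : Plane => q 1) (ht p hp).2
    simpa [circlePoint] using this.symm
  have hρpos : ∀ p ∈ L, 0 < ρ := fun p hp => (norm_nonneg p).trans_lt (hρ0 p hp)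
  have hnorm : ∀ p ∈ L, ‖p + t p • v p‖ = ρ := fun p hp => by
    rw [← (ht p hp).2, norm_circlePoint (hρpos p hp).le]
  -- Subtracting c·π from the angles, that is, applying the sign `ε`, brings the whole block to the
  -- right half circle.
  have hφ : ∀ p ∈ L, θ p - c * Real.pi ∈ Set.Ico (-(Real.pi / 2)) (Real.pi / 2) := fun p hp => by
    have h := hc p hp
    rw [Int.floor_eq_iff] at h
    have hpi := Real.pi_pos
    have h1 : θ p / Real.pi * Real.pi = θ p := div_mul_cancel₀ _ hpi.ne'
    constructor <;> nlinarith
  have hεcos : ∀ p ∈ L, ε * p 0 + t p * (ε * v p 0) = ρ * Real.cos (θ p - c * Real.pi) :=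
    fun p hp => by
      rw [Real.cos_sub_int_mul_pi, ← hε]
      linear_combination ε * hcos p hp
  have hεsin : ∀ p ∈ L, ε * p 1 + t p * (ε * v p 1) = ρ * Real.sin (θ p - c * Real.pi) :=
    fun p hp => by
      rw [Real.sin_sub_int_mul_pi, ← hε]
      linear_combination ε * hsin p hp
  -- No crossing lies on the vertical axis: a vertical ray misses the axis because its apex does,
  -- and any other ray is already far on its own side. This excludes the closed endpoint -π/2.
  have hne : ∀ p ∈ L, p 0 + t p * v p 0 ≠ 0 := fun p hp h0 => by
    by_cases hv0 : v p 0 = 0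
    · rw [hv0, mul_zero, add_zero] at h0
      exact hS p (hL p hp) h0
    · have := dir_mul_pos_of_far hv0 (hρ p (hL p hp)) (ht p hp).1 (hnorm p hp)
      rw [h0, mul_zero] at this
      exact lt_irrefl _ this
  have hright : ∀ p ∈ L, 0 < ε * p 0 + t p * (ε * v p 0) := fun p hp => by
    refine lt_of_le_of_ne ?_ ?_
    · rw [hεcos p hp]
      exact mul_nonneg (hρpos p hp).le
        (Real.cos_nonneg_of_neg_pi_div_two_le_of_le (hφ p hp).1 (hφ p hp).2.le)
    · intro h0
      refine hne p hp ((mul_eq_zero.1 (?_ : ε * (p 0 + t p * v p 0) = 0)).resolve_left hε0)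
      linear_combination -h0
  refine ⟨t, ⟨fun p hp => ?_, fun p hp => (ht p hp).1, fun p hp => ?_, hright, fun p hp => ?_,
    fun p hp q hq hpq => ?_, ?_⟩⟩
  · have h1 := plane_norm_sq p
    have h2 : ‖p‖ ^ 2 < ρ ^ 2 := by
      gcongr
      exact hρ0 p hp
    linear_combination h2 + (p 0 ^ 2 + p 1 ^ 2) * hε2 + h1
  · by_cases hv0 : v p 0 = 0
    · simp [hv0]
    · have h1 := dir_mul_pos_of_far hv0 (hρ p (hL p hp)) (ht p hp).1 (hnorm p hp)
      have h2 := hright p hp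
      have h3 : 0 < (ε * v p 0) * (ε * p 0 + t p * (ε * v p 0)) := by
        have : (ε * v p 0) * (ε * p 0 + t p * (ε * v p 0)) =
            (ε * ε) * (v p 0 * (p 0 + t p * v p 0)) := by ring
        rw [this, hε2, one_mul]
        exact h1
      exact ((mul_pos_iff_of_pos_right h2).1 h3).le
  · rw [hεcos p hp, hεsin p hp]
    nlinarith [Real.sin_sq_add_cos_sq (θ p - c * Real.pi)]
  · intro a ha b hb h1 h2
    refine Set.disjoint_left.1 (hv.2 p (hL p hp) q (hL q hq) hpq)
      (show p + a • v p ∈ ray p (v p) from ⟨a, ha, rfl⟩) ⟨b, hb, ?_⟩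
    ext i
    fin_cases i
    · simp
      exact mul_left_cancel₀ hε0 (by linear_combination h1)
    · simp
      exact mul_left_cancel₀ hε0 (by linear_combination h2)
  · refine hθ.imp_of_mem fun {p q} hp hq hpq => ?_
    rw [hεsin p hp, hεsin q hq]
    refine mul_lt_mul_of_pos_left ?_ (hρpos p hp)
    exact Real.sin_lt_sin_of_lt_of_le_pi_div_two (hφ q hq).1 (hφ p hp).2.le (by linarith)

/-! ### Few runs in every feasible word -/

theorem colour_clusteredSet_eq_true {n : ℕ} {p : Plane} :
    (clusteredSet n).colour p = true ↔ p ∈ (clusteredSet n).red := by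
  simp [BichromaticPointSet.colour]

theorem mem_blue_of_colour_eq_false {n : ℕ} {p : Plane} (hp : p ∈ (clusteredSet n).points)
    (h : (clusteredSet n).colour p = false) : p ∈ (clusteredSet n).blue := by
  rcases hp with hr | hb
  · rw [colour_clusteredSet_eq_true.2 hr] at h
    cases h
  · exact hb

theorem red_fst_mem {n : ℕ} {p : Plane} (hp : p ∈ (clusteredSet n).red) :
    p 0 ∈ Set.Icc (-1 - curvature n * heightBound n ^ 2) (-1) := by
  obtain ⟨i, hi, rfl⟩ := mem_red_clusteredSet.1 hp
  obtain ⟨h1, h2⟩ := curvature_mul_sq_mem (natCast_mem_heightBound hi)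
  simp only [redPoint, parabolaPoint_zero]
  constructor <;> linarith

theorem blue_fst_mem {n : ℕ} {p : Plane} (hp : p ∈ (clusteredSet n).blue) :
    p 0 ∈ Set.Icc 1 (1 + curvature n * heightBound n ^ 2) := by
  obtain ⟨i, hi, rfl⟩ := mem_blue_clusteredSet.1 hp
  obtain ⟨h1, h2⟩ := curvature_mul_sq_mem (blueHeight_mem hi)
  simp only [bluePoint, parabolaPoint_zero]
  constructor <;> linarith

theorem clusteredSet_fst_ne_zero {n : ℕ} {p : Plane} (hp : p ∈ (clusteredSet n).points) :
    p 0 ≠ 0 := by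
  rcases hp with h | h
  · have := (red_fst_mem h).2
    linarith
  · have := (blue_fst_mem h).1
    linarith

theorem clusteredSet_snd_mem {n : ℕ} {p : Plane} (hp : p ∈ (clusteredSet n).points) :
    p 1 ∈ Set.Icc 0 (heightBound n) := by
  obtain ⟨σ, y, -, hy, rfl⟩ := exists_parabolaPoint_of_mem_points hp
  simpa using hy

theorem one_le_abs_red_snd_sub {n : ℕ} {p q : Plane} (hp : p ∈ (clusteredSet n).red)
    (hq : q ∈ (clusteredSet n).red) (hpq : p ≠ q) : 1 ≤ |p 1 - q 1| := by
  obtain ⟨i, -, rfl⟩ := mem_red_clusteredSet.1 hp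
  obtain ⟨j, -, rfl⟩ := mem_red_clusteredSet.1 hq
  have hij : (i : ℤ) - j ≠ 0 := fun h => hpq (by rw [show i = j by omega])
  simp only [redPoint, parabolaPoint_one]
  exact_mod_cast Int.one_le_abs hij

theorem abs_red_snd_sub_le {n : ℕ} {p q : Plane} (hp : p ∈ (clusteredSet n).red)
    (hq : q ∈ (clusteredSet n).red) : |p 1 - q 1| ≤ n := by
  obtain ⟨i, hi, rfl⟩ := mem_red_clusteredSet.1 hp
  obtain ⟨j, hj, rfl⟩ := mem_red_clusteredSet.1 hq
  simp only [redPoint, parabolaPoint_one]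
  have h1 : (i : ℝ) ≤ n := by exact_mod_cast hi.le
  have h2 : (j : ℝ) ≤ n := by exact_mod_cast hj.le
  have h3 : (0 : ℝ) ≤ i := i.cast_nonneg
  have h4 : (0 : ℝ) ≤ j := j.cast_nonneg
  rw [abs_le]
  constructor <;> linarith

theorem exists_blue_index (n : ℕ) : ∃ idx : Plane → ℕ, ∀ p ∈ (clusteredSet n).blue,
    idx p < n ∧ bluePoint n (idx p) = p := by
  have : ∀ p : Plane, ∃ j, p ∈ (clusteredSet n).blue → j < n ∧ bluePoint n j = p := fun p => by
    by_cases hp : p ∈ (clusteredSet n).blue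
    · obtain ⟨j, h⟩ := mem_blue_clusteredSet.1 hp
      exact ⟨j, fun _ => h⟩
    · exact ⟨0, fun h => absurd h hp⟩
  choose idx h using this
  exact ⟨idx, h⟩

/-- For `ε = 1` the blue clusters are on the right; for `ε = -1` the half turn puts the red points
there. The two cases give 4m + 1 and 2m + 3 with m = `clusterCount n`, and the stated bound covers
both. -/
theorem clusteredSet_block_length_le {n : ℕ} {ρ ε : ℝ} {v : Plane → Plane} {t : Plane → ℝ}
    {L : List Plane} (hε : ε = 1 ∨ ε = -1)
    (h : RayBlock ρ (fun p => ε * p 0) (fun p => ε * p 1) (fun p => ε * v p 0)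
      (fun p => ε * v p 1) t L)
    (hL : ∀ p ∈ L, p ∈ (clusteredSet n).points)
    (hchain : L.IsChain fun p q => (clusteredSet n).colour p ≠ (clusteredSet n).colour q) :
    L.length ≤ 4 * clusterCount n + 3 := by
  obtain ⟨idx, hidx⟩ := exists_blue_index n
  have hsnd : ∀ p ∈ (clusteredSet n).blue, p 1 = blueHeight n (idx p) := fun p hp => by
    conv_lhs => rw [← (hidx p hp).2]
    simp [bluePoint]
  have heH : curvature n * heightBound n ^ 2 * heightBound n ≤ 1 / 4 := by
    have := curvature_mul_cube n
    nlinarith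
  have hred : ∀ p ∈ L, (clusteredSet n).colour p = true → p ∈ (clusteredSet n).red :=
    fun p _ hc => colour_clusteredSet_eq_true.1 hc
  have hblue : ∀ p ∈ L, (clusteredSet n).colour p = false → p ∈ (clusteredSet n).blue :=
    fun p hp hc => mem_blue_of_colour_eq_false (hL p hp) hc
  have hH : ∀ p ∈ L, ∀ q ∈ L, |ε * p 1 - ε * q 1| ≤ heightBound n := fun p hp q hq => by
    obtain ⟨h1, h2⟩ := clusteredSet_snd_mem (hL p hp)
    obtain ⟨h3, h4⟩ := clusteredSet_snd_mem (hL q hq)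
    rw [abs_le]
    rcases hε with rfl | rfl <;> constructor <;> linarith
  have habs : ∀ a b : ℝ, |ε * a - ε * b| = |a - b| := fun a b => by
    rcases hε with rfl | rfl
    · simp
    · rw [← mul_sub, abs_mul]; simp
  rcases hε with rfl | rfl
  · have := h.length_le_of_clusters_right heH hH (c := false) hchain
      (fun p hp hc => by simpa using blue_fst_mem (hblue p hp hc))
      (fun p hp hc => by simpa using red_fst_mem (hred p hp hc))
      (fun p hp q hq hpq hcp hcq => by
        rw [habs]
        exact one_le_abs_red_snd_sub (hred p hp hcp) (hred q hq hcq) hpq)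
      (clusterCount n) (fun p => idx p / clusterCount n)
      (fun p hp hc => Nat.div_lt_of_lt_mul
        ((hidx p (hblue p hp hc)).1.trans (lt_clusterCount_mul_self n)))
      (fun p hp q hq hcp hcq hk => by
        rw [habs, hsnd p (hblue p hp hcp), hsnd q (hblue q hq hcq)]
        exact abs_blueHeight_sub_le hk)
    omega
  · have := h.length_le_of_clusters_left heH hH (c := true) (N := n) hchain
      (fun p hp hc => by
        obtain ⟨h1, h2⟩ := red_fst_mem (hred p hp hc)
        constructor <;> linarith)
      (fun p hp hc => by
        obtain ⟨h1, h2⟩ := blue_fst_mem (hblue p hp hc)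
        constructor <;> linarith)
      (fun p hp q hq hcp hcq => by
        rw [habs]
        exact abs_red_snd_sub_le (hred p hp hcp) (hred q hq hcq))
      (clusterCount n) (fun p => idx p / clusterCount n) (fun p => idx p % clusterCount n)
      (fun p _ _ => Nat.mod_lt _ (clusterCount_pos n))
      (fun p hp q hq hcp hcq hk => by
        rw [habs, hsnd p (hblue p hp hcp), hsnd q (hblue q hq hcq)]
        exact le_abs_blueHeight_sub hk)
      (fun p hp q hq hcp hcq hk hg => by
        rw [← (hidx p (hblue p hp hcp)).2, ← (hidx q (hblue q hq hcq)).2,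
          ← Nat.div_add_mod (idx p) (clusterCount n), ← Nat.div_add_mod (idx q) (clusterCount n)]
        rw [hk, hg])
    omega

/-- Every circular sequence that is feasible from the clustered set has few runs. -/
theorem exists_word_few_runs {n : ℕ} {C : Cycle Bool} (hC : (clusteredSet n).Feasible C) :
    ∃ l : List Bool, C = l ∧ l.length = 2 * n ∧
      (l.destutter (· ≠ ·)).length ≤ 12 * clusterCount n + 8 + 1 := by
  have hmem := hC.mem_configurations (clusteredSet_isBalanced n)
  obtain ⟨v, hv, hind⟩ := hC
  set S := clusteredSet n
  -- For a vertical ray the quotient is 0 by convention, and the condition reduces to ‖p‖ < ρ.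
  have hlarge : ∀ᶠ ρ : ℝ in atTop,
      ∀ p ∈ S.points, ‖p‖ + |p 0| / |v p 0| * ‖v p‖ < ρ :=
    (S.finite_points.eventually_all).2 fun p _ => eventually_gt_atTop _
  obtain ⟨ρ, ⟨l, θ, -, hl, hray, hθ, rfl⟩, hρ⟩ := (hind.and hlarge).exists
  refine ⟨l.map S.colour, rfl, ?_, ?_⟩
  · obtain ⟨h1, h2⟩ := hmem
    rw [Cycle.coe_toMultiset, Multiset.coe_count] at h1 h2
    have := List.count_true_add_count_false (l.map S.colour)
    omega
  · rw [← List.map_destutter (R := fun p q => S.colour p ≠ S.colour q) (by simp), List.length_map]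
    set L := l.destutter fun p q => S.colour p ≠ S.colour q
    have hsub : L.Sublist l := List.destutter_sublist _ l
    have hLθ := hθ.sublist hsub
    have hpi := Real.pi_pos
    set f : Plane → ℤ := fun p => ⌊θ p / Real.pi + 1 / 2⌋
    -- The angles span less than 2π, so the half-circle index takes at most three consecutive
    -- values, the largest at the head of the list. The default 0 matters only for the empty list.
    have hle : L.length ≤ 3 * (4 * clusterCount n + 3) := by
      refine length_le_of_antitone_blocks f _ 3 ((L.head?.map f).getD 0 - 2) L ?_ ?_ ?_
      · refine hLθ.imp fun {p q} hpq => ?_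
        have := hpq.1
        simp only [f]
        gcongr
      · have hflt : ∀ p q : Plane, θ q < θ p → θ p < θ q + 2 * Real.pi →
            f q ≤ f p ∧ f p ≤ f q + 2 := fun p q h1 h2 => by
          refine ⟨by simp only [f]; gcongr, ?_⟩
          simp only [f]
          rw [← Int.floor_add_ofNat]
          refine Int.floor_le_floor ?_
          have h3 : θ p / Real.pi ≤ θ q / Real.pi + 2 := by
            rw [div_add' _ _ _ hpi.ne']
            gcongr
          linarith
        intro p hp
        rcases hLx : L with _ | ⟨x, L'⟩
        · simp [hLx] at hp
        · rw [hLx] at hLθ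
          simp only [List.head?_cons, Option.map_some, Option.getD_some]
          rcases List.mem_cons.1 (hLx ▸ hp) with rfl | hp'
          · omega
          · obtain ⟨h1, h2⟩ := List.rel_of_pairwise_cons hLθ hp'
            have := hflt x p h1 h2
            push_cast
            omega
      · intro L' hL' c hc
        have hsub' : L'.Sublist l := hL'.sublist.trans hsub
        obtain ⟨t, hblock⟩ := rayBlock_of_floor_eq hv (fun p hp => clusteredSet_fst_ne_zero hp) hρ
          (c := c) rfl (L := L') (fun p hp => (hl p).1 (hsub'.subset hp))
          (fun p hp => hray p (hsub'.subset hp)) ((hθ.sublist hsub').imp fun h => h.1) hc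
        refine clusteredSet_block_length_le ?_ hblock
          (fun p hp => (hl p).1 (hsub'.subset hp)) ((List.isChain_destutter _ l).infix hL')
        rcases Int.even_or_odd c with h | h <;> simp [h.neg_one_zpow]
    omega

/-! ### Asymptotic estimates -/

theorem numFeasible_clusteredSet_le (n : ℕ) :
    numFeasible (clusteredSet n) ≤ 2 * (2 * n + 1) ^ (12 * n.sqrt + 21) := by
  obtain ⟨hfin, hcard⟩ := ncard_cycles_few_runs_le (2 * n) (12 * clusterCount n + 8)
  exact (Set.ncard_le_ncard (fun C hC => exists_word_few_runs hC) hfin).trans hcard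

theorem numFeasible_clusteredSet_le_exp {n : ℕ} (hn : 3 ≤ n) :
    (numFeasible (clusteredSet n) : ℝ) ≤ 2 * Real.exp (66 * (Real.sqrt n * Real.log n)) := by
  have hn' : (3 : ℝ) ≤ n := by exact_mod_cast hn
  have h1 : (numFeasible (clusteredSet n) : ℝ) ≤ 2 * (2 * n + 1) ^ (12 * n.sqrt + 21) := by
    exact_mod_cast numFeasible_clusteredSet_le n
  refine h1.trans ?_
  have hlog : 0 ≤ Real.log n := Real.log_nonneg (by linarith)
  have h2 : (2 * n + 1 : ℝ) ≤ Real.exp (2 * Real.log n) := by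
    rw [two_mul (Real.log n), Real.exp_add, Real.exp_log (by linarith)]
    nlinarith
  have h3 : (n.sqrt : ℝ) ≤ Real.sqrt n := Real.nat_sqrt_le_real_sqrt
  have h4 : 1 ≤ Real.sqrt n := Real.one_le_sqrt.2 (by linarith)
  refine mul_le_mul_of_nonneg_left ?_ zero_le_two
  calc (2 * n + 1 : ℝ) ^ (12 * n.sqrt + 21)
      ≤ Real.exp (2 * Real.log n) ^ (12 * n.sqrt + 21) := by gcongr
    _ = Real.exp ((12 * n.sqrt + 21 : ℕ) * (2 * Real.log n)) := by rw [Real.exp_nat_mul]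
    _ ≤ _ := by
      -- Here 12√n + 21 ≤ 33√n because √n ≥ 1, and the base contributes 2 log n, whence 66.
      refine Real.exp_le_exp.2 ?_
      push_cast
      nlinarith [mul_le_mul_of_nonneg_right h3 hlog, mul_le_mul_of_nonneg_right h4 hlog]

/-- Crude bounds suffice: e^n ≤ 4^n ≤ 2n(2n + 1)Γ(n), and 2n(2n + 1) ≤ n⁴ once n ≥ 3. -/
theorem exp_le_numConfigurations {n : ℕ} (hn : 3 ≤ n) :
    Real.exp (n - 4 * Real.log n) ≤ numConfigurations n := by
  have hn' : (3 : ℝ) ≤ n := by exact_mod_cast hn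
  have h1 : (4 : ℝ) ^ n ≤ 2 * n * n.centralBinom := by
    exact_mod_cast Nat.four_pow_le_two_mul_self_mul_centralBinom n (by omega)
  have h2 : (n.centralBinom : ℝ) ≤ (2 * n + 1) * numConfigurations n := by
    exact_mod_cast centralBinom_le_mul_numConfigurations n
  have h3 : Real.exp n ≤ 4 ^ n := by
    rw [← Real.exp_one_pow]
    gcongr
    linarith [Real.exp_one_lt_d9]
  have h4 : Real.exp (4 * Real.log n) = (n : ℝ) ^ 4 := by
    rw [← Real.exp_log (show (0 : ℝ) < n by linarith), ← Real.exp_nat_mul, Real.log_exp]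
    norm_num
  rw [Real.exp_sub, h4, div_le_iff₀ (by positivity)]
  have h5 : 2 * n * (2 * n + 1) ≤ (n : ℝ) ^ 4 := by nlinarith [sq_nonneg ((n : ℝ) ^ 2 - 9)]
  have h6 : (0 : ℝ) ≤ numConfigurations n := Nat.cast_nonneg _
  calc Real.exp n ≤ 2 * n * ((2 * n + 1) * numConfigurations n) :=
        h3.trans (h1.trans (by gcongr))
    _ = numConfigurations n * (2 * n * (2 * n + 1)) := by ring
    _ ≤ _ := by gcongr

/-- The constant is 70 = 66 + 4: besides the exponent of the upper bound it absorbs the 4 log n lost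
in `exp_le_numConfigurations`. -/
theorem eventually_sqrt_mul_log_le :
    ∀ᶠ n : ℕ in atTop, 70 * (Real.sqrt n * Real.log n) ≤ (n : ℝ) / 2 := by
  have h := (isLittleO_log_rpow_atTop (r := 1 / 2) (by norm_num)).def
    (show (0 : ℝ) < 1 / 140 by norm_num)
  filter_upwards [tendsto_natCast_atTop_atTop.eventually h, eventually_ge_atTop 1] with n hn hn1
  have hn0 : (0 : ℝ) ≤ n := n.cast_nonneg
  rw [← Real.sqrt_eq_rpow, Real.norm_of_nonneg (Real.sqrt_nonneg _)] at hn
  have h1 := (Real.le_norm_self _).trans hn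
  nlinarith [mul_le_mul_of_nonneg_left h1 (Real.sqrt_nonneg n), Real.mul_self_sqrt hn0]

theorem mainTheorem5 :
    (∃ d : ℝ, 0 < d ∧
      (fun n : ℕ => (gammaMinGP n : ℝ)) =O[atTop]
        (fun n : ℕ => (2 : ℝ) ^ (d * Real.sqrt (n : ℝ) * Real.log (n : ℝ)))) ∧
    (∃ S : ℕ → BichromaticPointSet,
      (∀ n : ℕ, (S n).IsBalanced n ∧ (S n).GeneralPosition) ∧
      (fun n : ℕ => (numFeasible (S n) : ℝ)) =o[atTop]
        (fun n : ℕ => (numConfigurations n : ℝ))) := by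
  have hlog2 : 0 < Real.log 2 := Real.log_pos (by norm_num)
  refine ⟨⟨66 / Real.log 2, by positivity, ?_⟩, clusteredSet,
    fun n => ⟨clusteredSet_isBalanced n, clusteredSet_generalPosition n⟩, ?_⟩
  · refine IsBigO.of_bound 2 ?_
    filter_upwards [eventually_ge_atTop 3] with n hn
    have h1 : gammaMinGP n ≤ numFeasible (clusteredSet n) :=
      Nat.sInf_le ⟨_, clusteredSet_isBalanced n, clusteredSet_generalPosition n, rfl⟩
    have h2 : (2 : ℝ) ^ (66 / Real.log 2 * Real.sqrt n * Real.log n) =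
        Real.exp (66 * (Real.sqrt n * Real.log n)) := by
      rw [Real.rpow_def_of_pos (by norm_num)]
      congr 1
      field_simp
    rw [h2, Real.norm_of_nonneg (Nat.cast_nonneg _), Real.norm_of_nonneg (Real.exp_pos _).le]
    exact (Nat.cast_le.2 h1).trans (numFeasible_clusteredSet_le_exp hn)
  · rw [isLittleO_iff]
    intro c hc
    have htend : Tendsto (fun n : ℕ => Real.exp (-((n : ℝ) / 2))) atTop (nhds 0) :=
      Real.tendsto_exp_neg_atTop_nhds_zero.comp
        (tendsto_natCast_atTop_atTop.atTop_div_const (by norm_num))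
    filter_upwards [eventually_ge_atTop 3, eventually_sqrt_mul_log_le,
      htend.eventually_lt_const (show 0 < c / 2 by positivity)] with n hn hlog hexp
    have hn' : (3 : ℝ) ≤ n := by exact_mod_cast hn
    have hlog0 : 0 ≤ Real.log n := Real.log_nonneg (by linarith)
    have hsqrt : 1 ≤ Real.sqrt n := Real.one_le_sqrt.2 (by linarith)
    rw [Real.norm_of_nonneg (Nat.cast_nonneg _), Real.norm_of_nonneg (Nat.cast_nonneg _)]
    calc (numFeasible (clusteredSet n) : ℝ)
        ≤ 2 * Real.exp (66 * (Real.sqrt n * Real.log n)) := numFeasible_clusteredSet_le_exp hn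
      _ ≤ 2 * Real.exp (-((n : ℝ) / 2) + (n - 4 * Real.log n)) := by
        gcongr
        nlinarith
      _ = 2 * Real.exp (-((n : ℝ) / 2)) * Real.exp (n - 4 * Real.log n) := by
        rw [Real.exp_add, mul_assoc]
      _ ≤ c * numConfigurations n := by
        gcongr
        · linarith
        · exact exp_le_numConfigurations hn
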